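/- **Setting.** Let $S$ be a set of unit squares of the $\mathbb Z^2$ lattice in $\mathbb R^2$ and let $G$ be the subcomplex they define; its vertices and edges are the corners and sides of the squares in $S$. Assume that the union of the closed squares in $S$ is simply connected. A vertex is *interior* if all four squares around it belong to $S$. A *ring* is a pair of concentric circles in $\mathbb R^2=\mathbb C$: an inner circle $c$ of signed radius $r$ (positive: counter-clockwise, negative: clockwise, zero: a point) and an outer circle $C$ of radius $R>|r|$. An *orthogonal ring pattern* on $G$ assigns a ring to every vertex of $G$ so that: 1. for neighboring vertices $i,j$ of $G$ the circles $C_i$ and $c_j$ intersect orthogonally, and so do $c_i$ and $C_j$ (a circle of radius zero intersects orthogonally every circle through it); 2. in every square of $G$ with lower left corner $(m,n)$, the circles $c_{m,n}$, $c_{m+1,n+1}$, $C_{m+1,n}$, $C_{m,n+1}$ pass through one point $t$, and $C_{m+1,n}$, $C_{m,n+1}$ touch there with their centers on opposite sides; 3. the points $c_{m,n}\cap C_{m+1,n}\setminus C_{m,n+1}$, $t$, $c_{m,n}\cap C_{m,n+1}\setminus C_{m+1,n}$ exist and are in counter-clockwise order on $c_{m,n}$ if $r_{m,n}>0$, and in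 clockwise order if $r_{m,n}<0$; likewise the points $c_{m+1,n+1}\cap C_{m,n+1}\setminus C_{m+1,n}$, $t$, $c_{m+1,n+1}\cap C_{m+1,n}\setminus C_{m,n+1}$ exist and have on $c_{m+1,n+1}$ the orientation given by the sign of $r_{m+1,n+1}$ if that is nonzero. **Theorem.** (a) For every orthogonal ring pattern on $G$ there are $\ell_0>0$ and real numbers $\rho_i$ (the *$\rho$-radii*) with $R_i=\ell_0\cosh\rho_i$ and $r_i=\ell_0\sinh\rho_i$ at all vertices $i$, and for every such $\ell_0,\rho$ and every interior vertex $i$ $$2\pi=\sum_{j\sim i}2\arctan\bigl(e^{\rho_i-\rho_j}\bigr),$$ the sum being over the four neighbors $j$ of $i$. (b) Conversely, let $\rho$ be any real function on the vertices of $G$ satisfying this equation at every interior vertex (some $\rho_i$ may be zero), and let $\ell_0>0$. Then there exists an orthogonal ring pattern on $G$ with $R_i=\ell_0\cosh\rho_i$, $r_i=\ell_0\sinh\rho_i$. If moreover any two squares in $S$ are joined by a chain of squares in $S$ in which consecutive squares share a side (so that $G$ is not pinched at a vertex), this pattern is unique up to a rotation and a translation of the plane. -/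

import Mathlib

/-- The square lattice `ℤ²` as a graph. It is used both for lattice points and for unit squares
(a unit square is named by its lower left corner, and squares with a common side are adjacent). -/
def latticeGraph : SimpleGraph (ℤ × ℤ) where
  Adj v w := (v.2 = w.2 ∧ |v.1 - w.1| = 1) ∨ (v.1 = w.1 ∧ |v.2 - w.2| = 1)
  symm := ⟨fun v w h => by
    rcases h with ⟨h1, h2⟩ | ⟨h1, h2⟩
    · exact Or.inl ⟨h1.symm, by rw [abs_sub_comm]; exact h2⟩
    · exact Or.inr ⟨h1.symm, by rw [abs_sub_comm]; exact h2⟩⟩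
  loopless := ⟨fun v h => by simp at h⟩

/-- The four corners of the unit square with lower left corner `p`. -/
def squareCorners (p : ℤ × ℤ) : Set (ℤ × ℤ) :=
  {p, (p.1 + 1, p.2), (p.1 + 1, p.2 + 1), (p.1, p.2 + 1)}

/-- The vertices of the subcomplex of the `ℤ²` lattice that is defined by a set `S` of squares. -/
def vertexSet (S : Set (ℤ × ℤ)) : Set (ℤ × ℤ) :=
  {v | ∃ p ∈ S, v ∈ squareCorners p}

/-- `v` and `w` are neighbors in the subcomplex: they are the endpoints of a side of one of
its squares. -/
def IsEdge (S : Set (ℤ × ℤ)) (v w : ℤ × ℤ) : Prop :=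
  latticeGraph.Adj v w ∧ ∃ p ∈ S, v ∈ squareCorners p ∧ w ∈ squareCorners p

/-- The underlying space of the subcomplex: the union of its closed unit squares. -/
def carrier (S : Set (ℤ × ℤ)) : Set (ℝ × ℝ) :=
  ⋃ p ∈ S, Set.Icc (p.1 : ℝ) (p.1 + 1) ×ˢ Set.Icc (p.2 : ℝ) (p.2 + 1)

/-- `v` is an interior vertex: all four squares around it belong to the subcomplex. -/
def IsInteriorVertex (S : Set (ℤ × ℤ)) (v : ℤ × ℤ) : Prop :=
  (v.1, v.2) ∈ S ∧ (v.1 - 1, v.2) ∈ S ∧ (v.1 - 1, v.2 - 1) ∈ S ∧ (v.1, v.2 - 1) ∈ S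

/-- The four lattice neighbors of `v`. -/
def latticeNeighbors (v : ℤ × ℤ) : Finset (ℤ × ℤ) :=
  {(v.1 + 1, v.2), (v.1, v.2 + 1), (v.1 - 1, v.2), (v.1, v.2 - 1)}

/-- A ring: two concentric circles in the plane `ℝ² = ℂ`. The inner radius carries a sign (positive:
counter-clockwise, negative: clockwise), the outer radius is positive. An inner circle of radius
zero is a point. -/
structure OrientedRing where
  center : ℂ
  inner : ℝ
  outer : ℝ
  abs_inner_lt_outer : |inner| < outer

/-- The inner circle of a ring. -/
def OrientedRing.innerCircle (A : OrientedRing) : Set ℂ := Metric.sphere A.center |A.inner|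

/-- The outer circle of a ring. -/
def OrientedRing.outerCircle (A : OrientedRing) : Set ℂ := Metric.sphere A.center A.outer

/-- The outer circle of `A` and the inner circle of `B` intersect orthogonally: they have a common
point at which their radii are perpendicular. -/
def OuterInnerOrthogonal (A B : OrientedRing) : Prop :=
  ∃ x ∈ A.outerCircle ∩ B.innerCircle, inner ℝ (x - A.center) (x - B.center) = 0

/-- Two rings intersect orthogonally. -/
def RingsOrthogonal (A B : OrientedRing) : Prop :=
  OuterInnerOrthogonal A B ∧ OuterInnerOrthogonal B A

/-- The triangle `x, y, z` is positively oriented. For three points of a circle: they are in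
counter-clockwise order on the circle. -/
def IsCCW (x y z : ℂ) : Prop :=
  0 < (starRingEnd ℂ (y - x) * (z - x)).im

/-- Orientation rule at a ring `A` whose neighbors in a square are `B` and `D` (in the
counter-clockwise order of the lattice), where `t` is the point common to the inner circle of `A`
and the outer circles of `B` and `D`: the second intersection point of `A` with `B`, the point `t`,
and the second intersection point of `A` with `D` are in counter-clockwise order on the
inner circle of `A` if its radius is positive, and in clockwise order if it is negative.
An inner circle of radius zero has no orientation. -/
def CornerOriented (A B D : OrientedRing) (t : ℂ) : Prop :=
  (0 < A.inner →
    ∃ x ∈ (A.innerCircle ∩ B.outerCircle) \ D.outerCircle,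
    ∃ y ∈ (A.innerCircle ∩ D.outerCircle) \ B.outerCircle, IsCCW x t y) ∧
  (A.inner < 0 →
    ∃ x ∈ (A.innerCircle ∩ B.outerCircle) \ D.outerCircle,
    ∃ y ∈ (A.innerCircle ∩ D.outerCircle) \ B.outerCircle, IsCCW y t x)

/-- The condition on the rings `A, B, C, D` at the corners `(m,n), (m+1,n), (m+1,n+1), (m,n+1)`
of a square: the inner circles of `A, C` and the outer circles of `B, D` pass through one point,
where the outer circles (which are always positively oriented) touch with their centers on
opposite sides, and the orientation rule holds at `A` and at `C`. For `A.inner` or `C.inner`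
different from zero, orthogonality already implies that the outer circles have a common tangent;
if both vanish it has to be asked for. -/
def SquareCondition (A B C D : OrientedRing) : Prop :=
  ∃ t : ℂ, t ∈ A.innerCircle ∧ t ∈ C.innerCircle ∧ t ∈ B.outerCircle ∧ t ∈ D.outerCircle ∧
    Sbtw ℝ B.center t D.center ∧ CornerOriented A B D t ∧ CornerOriented C D B t

/-- `P` assigns rings to the vertices of the subcomplex defined by the squares in `S` such that
they form an orthogonal ring pattern. (Values of `P` at other lattice points are irrelevant.) -/
structure IsOrthogonalRingPattern (S : Set (ℤ × ℤ)) (P : ℤ × ℤ → OrientedRing) : Prop where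
  orthogonal : ∀ v w, IsEdge S v w → RingsOrthogonal (P v) (P w)
  square : ∀ m n : ℤ, (m, n) ∈ S →
    SquareCondition (P (m, n)) (P (m + 1, n)) (P (m + 1, n + 1)) (P (m, n + 1))

/-- The rings at the vertices have the radii `R = ℓ cosh ρ` and `r = ℓ sinh ρ`. -/
def HasRhoRadii (S : Set (ℤ × ℤ)) (P : ℤ × ℤ → OrientedRing) (ℓ : ℝ) (ρ : ℤ × ℤ → ℝ) : Prop :=
  ∀ v ∈ vertexSet S, (P v).outer = ℓ * Real.cosh (ρ v) ∧ (P v).inner = ℓ * Real.sinh (ρ v)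

/-- The closure equation at all interior vertices. -/
def ClosureEquation (S : Set (ℤ × ℤ)) (ρ : ℤ × ℤ → ℝ) : Prop :=
  ∀ v, IsInteriorVertex S v →
    2 * Real.pi = ∑ w ∈ latticeNeighbors v, 2 * Real.arctan (Real.exp (ρ v - ρ w))

/-!
Equality of `R² - r²` at neighboring vertices gives the `ρ`-radii. A square with lower left corner
`p` satisfies its conditions exactly if it has a frame: a point `t` and a unit direction `w` such
that, counter-clockwise from `p`, the centers of its four rings are `t - i w r`, `t + w R`,
`t + i w r` and `t - w R`. When a side is crossed from one square to the next, with the vertex `u`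
on the right and `v` on the left, the lengths and directions of this side in the two frames show
that `w` is turned by `gd (ρ u - ρ v)`, where `gd x = 2 arctan (exp x) - π / 2` is the Gudermannian
function. Going around an interior vertex `v`, these angles sum to a multiple of `2π` of absolute
value less than `2π`, hence to zero, which is the closure equation.

Conversely, the closure equation says that the prescribed angles form a closed discrete one-form.
On a simply connected complex it is exact, which gives the directions of all frames, and the sides
of the squares in these frames form a second closed one-form, which gives the centers. Exactness is
monodromy: a locally constant cocycle on the carrier defines a covering space, which has a section.
-/

section Topology

variable {X ι M : Type*} [TopologicalSpace X]

/-- The bundle over `X` with discrete fibre `M` (a covering space of `X`) whose transition function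
on `U i ∩ U j` is the translation by `c i j`. Its sections are the locally constant solutions of
`-F i + F j = c i j`. The set `U (idx x)` serves as the default chart at `x`. -/
def cocycleBundle [AddGroup M] [TopologicalSpace M] [DiscreteTopology M] {U : ι → Set X}
    (hUo : ∀ i, IsOpen (U i)) (idx : X → ι) (hidx : ∀ x, x ∈ U (idx x)) (c : ι → ι → M)
    (hc : ∀ i j k x, x ∈ U i → x ∈ U j → x ∈ U k → c i j + c j k = c i k) :
    FiberBundleCore ι X M where
  baseSet := U
  isOpen_baseSet := hUo
  indexAt := idx
  mem_baseSet_at := hidx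
  coordChange i j _ m := m + c i j
  coordChange_self i x hx m := by simpa using hc i i i x hx hx hx
  continuousOn_coordChange i j :=
    ((continuous_of_discreteTopology (f := fun m : M => m + c i j)).comp
      continuous_snd).continuousOn
  coordChange_comp i j k x hx m := by
    rw [add_assoc, hc i j k x hx.1.1 hx.1.2 hx.2]

theorem exists_continuousOn_coboundary [SimplyConnectedSpace X] [LocallyPathConnectedSpace X]
    [AddGroup M] [TopologicalSpace M] [DiscreteTopology M] {U : ι → Set X}
    (hUo : ∀ i, IsOpen (U i)) (hcov : ∀ x, ∃ i, x ∈ U i) (c : ι → ι → M)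
    (hc : ∀ i j k x, x ∈ U i → x ∈ U j → x ∈ U k → c i j + c j k = c i k) :
    ∃ f : ι → X → M, (∀ i, ContinuousOn (f i) (U i)) ∧
      ∀ i j, ∀ x ∈ U i ∩ U j, f i x + c i j = f j x := by
  choose idx hidx using hcov
  let Z := cocycleBundle hUo idx hidx c hc
  have hcover : IsCoveringMap (Bundle.TotalSpace.proj : Bundle.TotalSpace M Z.Fiber → X) :=
    FiberBundle.isCoveringMap
  obtain ⟨x₀⟩ : Nonempty X := inferInstance
  obtain ⟨s, ⟨-, hs⟩, -⟩ := hcover.existsUnique_continuousMap_lifts (ContinuousMap.id X) x₀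
    (⟨x₀, (0 : M)⟩ : Bundle.TotalSpace M Z.Fiber) rfl
  have hproj : ∀ x, (s x).1 = x := congrFun hs
  refine ⟨fun i x => (Z.localTriv i (s x)).2, fun i => ?_, fun i j x ⟨hi, hj⟩ => ?_⟩
  · have hmaps : Set.MapsTo s (U i) (Z.localTriv i).source := fun x hx => by
      rw [(Z.localTriv i).source_eq]
      change (s x).1 ∈ U i
      rwa [hproj]
    exact continuous_snd.comp_continuousOn
      ((Z.localTriv i).continuousOn_toFun.comp s.continuous.continuousOn hmaps)
  · let m : M := (s x).2
    have hcoord (k : ι) : (Z.localTriv k (s x)).2 = m + c (idx x) k :=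
      congrArg (fun y => m + c (idx y) k) (hproj x)
    simp only [hcoord, add_assoc, hc (idx x) i j x (hidx x) hi hj]

theorem exists_coboundary_of_simplyConnected [SimplyConnectedSpace X] [LocallyPathConnectedSpace X]
    [AddGroup M] {U : ι → Set X} (hUo : ∀ i, IsOpen (U i)) (hUc : ∀ i, IsPreconnected (U i))
    (hcov : ∀ x, ∃ i, x ∈ U i) (c : ι → ι → M)
    (hc : ∀ i j k x, x ∈ U i → x ∈ U j → x ∈ U k → c i j + c j k = c i k) :
    ∃ F : ι → M, ∀ i j, (U i ∩ U j).Nonempty → -F i + F j = c i j := by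
  let _ : TopologicalSpace M := ⊥
  have _ : DiscreteTopology M := ⟨rfl⟩
  obtain ⟨f, hf, hfc⟩ := exists_continuousOn_coboundary hUo hcov c hc
  have hconst (i : ι) : ∃ m, ∀ x ∈ U i, f i x = m := by
    rcases (U i).eq_empty_or_nonempty with h | ⟨y, hy⟩
    · exact ⟨0, by simp [h]⟩
    · exact ⟨f i y, fun x hx => (hUc i).constant (hf i) hx hy⟩
  choose F hF using hconst
  refine ⟨F, fun i j ⟨x, hi, hj⟩ => ?_⟩
  rw [← hF i x hi, ← hF j x hj, ← hfc i j x ⟨hi, hj⟩, neg_add_cancel_left]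

theorem eq_of_isPreconnected_iUnion {U : ι → Set X} (hfin : LocallyFinite U)
    (hUc : ∀ i, IsClosed (U i)) (hne : ∀ i, (U i).Nonempty) (hU : IsPreconnected (⋃ i, U i))
    {f : ι → M} (hf : ∀ i j, (U i ∩ U j).Nonempty → f i = f j) (i j : ι) : f i = f j := by
  by_contra hij
  have hclosed (T : Set ι) : IsClosed (⋃ k : T, U k) :=
    (hfin.comp_injective Subtype.val_injective).isClosed_iUnion fun k => hUc k
  have hmem {T : Set ι} {k : ι} (hk : k ∈ T) : U k ⊆ ⋃ k : T, U k :=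
    Set.subset_iUnion_of_subset ⟨k, hk⟩ subset_rfl
  have hmeets {T : Set ι} {k : ι} (hk : k ∈ T) : ((⋃ i, U i) ∩ ⋃ k : T, U k).Nonempty :=
    (hne k).mono (Set.subset_inter (Set.subset_iUnion U k) (hmem hk))
  have hcover : ⋃ k, U k ⊆ (⋃ k : {k | f k = f i}, U k) ∪ ⋃ k : {k | f k ≠ f i}, U k :=
    Set.iUnion_subset fun k => (em (f k = f i)).elim
      (fun hk => (hmem hk).trans Set.subset_union_left)
      fun hk => (hmem hk).trans Set.subset_union_right
  obtain ⟨x, -, hx, hx'⟩ := isPreconnected_closed_iff.1 hU _ _ (hclosed {k | f k = f i})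
    (hclosed {k | f k ≠ f i}) hcover (hmeets rfl) (hmeets (Ne.symm hij))
  obtain ⟨⟨k, hk⟩, hxk⟩ := Set.mem_iUnion.1 hx
  obtain ⟨⟨k', hk'⟩, hxk'⟩ := Set.mem_iUnion.1 hx'
  exact hk' ((hf k k' ⟨x, hxk, hxk'⟩).symm.trans hk)

end Topology

section Convex

variable {E ι : Type*} [NormedAddCommGroup E] [NormedSpace ℝ E] {s : ι → Set E}

theorem starConvex_inter_iUnion {t : Set E} {x : E} (ht : Convex ℝ t) (hx : x ∈ t)
    (hs : ∀ i, Convex ℝ (s i)) (h : ∀ i, ∀ y ∈ t, y ∈ s i → x ∈ s i) :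
    StarConvex ℝ x (t ∩ ⋃ i, s i) := by
  rw [starConvex_iff_segment_subset]
  rintro y ⟨hyt, hy⟩
  obtain ⟨i, hi⟩ := Set.mem_iUnion.1 hy
  exact Set.subset_inter (ht.segment_subset hx hyt)
    (((hs i).segment_subset (h i y hyt hi) hi).trans (Set.subset_iUnion s i))

theorem locallyPathConnectedSpace_iUnion (hfin : LocallyFinite s) (hcl : ∀ i, IsClosed (s i))
    (hs : ∀ i, Convex ℝ (s i)) : LocallyPathConnectedSpace ↥(⋃ i, s i) := by
  have hball (x : E) : ∃ δ > 0, ∀ y ∈ Metric.ball x δ, ∀ i, y ∈ s i → x ∈ s i :=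
    Metric.eventually_nhds_iff_ball.1 (hfin.eventually_subset hcl x)
  choose δ hδ hsub using hball
  refine LocallyPathConnectedSpace.of_bases (p := fun x r => 0 < r ∧ r ≤ δ x.1)
    (s := fun x r => Metric.ball x r) (fun x => ?_) (fun x r hr => ?_)
  · exact Metric.nhds_basis_ball.to_hasBasis
      (fun r hr => ⟨min r (δ x), ⟨lt_min hr (hδ _), min_le_right _ _⟩,
        Metric.ball_subset_ball (min_le_left _ _)⟩)
      fun r hr => ⟨r, hr.1, subset_rfl⟩
  · rw [Topology.IsInducing.subtypeVal.isPathConnected_iff]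
    have himage : Subtype.val '' Metric.ball x r = Metric.ball x.1 r ∩ ⋃ i, s i := by
      rw [Set.inter_comm, ← Subtype.image_preimage_coe]
      rfl
    rw [himage]
    exact (starConvex_inter_iUnion (convex_ball x.1 r) (Metric.mem_ball_self hr.1) hs
      fun i y hy => hsub x y (Metric.ball_subset_ball hr.2 hy) i).isPathConnected
        ⟨Metric.mem_ball_self hr.1, x.2⟩

end Convex

theorem mem_squareCorners {p v : ℤ × ℤ} :
    v ∈ squareCorners p ↔ (p.1 ≤ v.1 ∧ v.1 ≤ p.1 + 1) ∧ p.2 ≤ v.2 ∧ v.2 ≤ p.2 + 1 := by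
  simp only [squareCorners, Set.mem_insert_iff, Set.mem_singleton_iff, Prod.ext_iff]
  lia

theorem latticeGraph_adj_iff {v w : ℤ × ℤ} :
    latticeGraph.Adj v w ↔ (v.2 = w.2 ∧ (v.1 = w.1 + 1 ∨ w.1 = v.1 + 1)) ∨
      (v.1 = w.1 ∧ (v.2 = w.2 + 1 ∨ w.2 = v.2 + 1)) := by
  simp only [latticeGraph, abs_eq zero_le_one]
  lia

theorem self_mem_squareCorners (p : ℤ × ℤ) : p ∈ squareCorners p := Set.mem_insert _ _

/-- The closed unit square with lower left corner `p`, as a subset of the plane that contains the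
carrier of a subcomplex. -/
def closedSquare (p : ℤ × ℤ) : Set (ℝ × ℝ) :=
  Set.Icc (p.1 : ℝ) (p.1 + 1) ×ˢ Set.Icc (p.2 : ℝ) (p.2 + 1)

/-- The lattice point `v` as a point of the plane that contains the carrier of a subcomplex. -/
def latticePoint (v : ℤ × ℤ) : ℝ × ℝ := (v.1, v.2)

theorem carrier_eq_iUnion (S : Set (ℤ × ℤ)) : carrier S = ⋃ p : S, closedSquare p :=
  Set.biUnion_eq_iUnion S fun p _ => closedSquare p

theorem mem_carrier {S : Set (ℤ × ℤ)} {x : ℝ × ℝ} :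
    x ∈ carrier S ↔ ∃ p ∈ S, x ∈ closedSquare p := by
  simp only [carrier, closedSquare, Set.mem_iUnion, exists_prop]

theorem mem_closedSquare {p : ℤ × ℤ} {x : ℝ × ℝ} :
    x ∈ closedSquare p ↔ ((p.1 : ℝ) ≤ x.1 ∧ x.1 ≤ p.1 + 1) ∧ (p.2 : ℝ) ≤ x.2 ∧ x.2 ≤ p.2 + 1 :=
  Iff.rfl

theorem convex_closedSquare (p : ℤ × ℤ) : Convex ℝ (closedSquare p) :=
  (convex_Icc _ _).prod (convex_Icc _ _)

theorem isClosed_closedSquare (p : ℤ × ℤ) : IsClosed (closedSquare p) :=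
  isClosed_Icc.prod isClosed_Icc

theorem latticePoint_mem_closedSquare {p v : ℤ × ℤ} :
    latticePoint v ∈ closedSquare p ↔ v ∈ squareCorners p := by
  rw [mem_closedSquare, mem_squareCorners]
  simp only [latticePoint]
  norm_cast

theorem mem_ball_prod_iff {x y : ℝ × ℝ} {r : ℝ} :
    y ∈ Metric.ball x r ↔ (x.1 - r < y.1 ∧ y.1 < x.1 + r) ∧ x.2 - r < y.2 ∧ y.2 < x.2 + r := by
  rw [← ball_prod_same, Set.mem_prod, Real.ball_eq_Ioo, Real.ball_eq_Ioo, Set.mem_Ioo, Set.mem_Ioo]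

theorem locallyFinite_closedSquare : LocallyFinite closedSquare := fun x => by
  refine ⟨Metric.ball x 1, Metric.ball_mem_nhds x one_pos, ((Set.finite_Icc (⌊x.1⌋ - 2)
    (⌊x.1⌋ + 2)).prod (Set.finite_Icc (⌊x.2⌋ - 2) (⌊x.2⌋ + 2))).subset ?_⟩
  rintro p ⟨y, hyp, hyx⟩
  obtain ⟨⟨a1, a2⟩, a3, a4⟩ := mem_closedSquare.1 hyp
  obtain ⟨⟨b1, b2⟩, b3, b4⟩ := mem_ball_prod_iff.1 hyx
  have c1 := Int.floor_le x.1
  have c2 := Int.lt_floor_add_one x.1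
  have c3 := Int.floor_le x.2
  have c4 := Int.lt_floor_add_one x.2
  simp only [Set.mem_prod, Set.mem_Icc]
  rify
  refine ⟨⟨?_, ?_⟩, ?_, ?_⟩ <;> linarith

theorem locallyFinite_closedSquare_subtype (S : Set (ℤ × ℤ)) :
    LocallyFinite fun p : S => closedSquare p :=
  locallyFinite_closedSquare.comp_injective Subtype.val_injective

theorem locallyPathConnectedSpace_carrier (S : Set (ℤ × ℤ)) :
    LocallyPathConnectedSpace (carrier S) := by
  rw [carrier_eq_iUnion]
  exact locallyPathConnectedSpace_iUnion (locallyFinite_closedSquare_subtype S)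
    (fun p => isClosed_closedSquare p) fun p => convex_closedSquare p

theorem mem_squareCorners_of_mem_ball {p v : ℤ × ℤ} {x : ℝ × ℝ} (hx : x ∈ closedSquare p)
    (hv : x ∈ Metric.ball (latticePoint v) 1) : v ∈ squareCorners p := by
  obtain ⟨⟨a1, a2⟩, a3, a4⟩ := mem_closedSquare.1 hx
  obtain ⟨⟨b1, b2⟩, b3, b4⟩ := mem_ball_prod_iff.1 hv
  simp only [latticePoint] at b1 b2 b3 b4
  have h1 : (v.1 : ℝ) < p.1 + 2 := by linarith
  have h2 : (p.1 : ℝ) < v.1 + 1 := by linarith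
  have h3 : (v.2 : ℝ) < p.2 + 2 := by linarith
  have h4 : (p.2 : ℝ) < v.2 + 1 := by linarith
  norm_cast at h1 h2 h3 h4
  rw [mem_squareCorners]
  lia

theorem exists_latticePoint_ball (x : ℝ × ℝ) : ∃ v, x ∈ Metric.ball (latticePoint v) 1 := by
  refine ⟨(round x.1, round x.2), mem_ball_prod_iff.2 ?_⟩
  have h1 := abs_le.1 (abs_sub_round x.1)
  have h2 := abs_le.1 (abs_sub_round x.2)
  simp only [latticePoint]
  refine ⟨⟨?_, ?_⟩, ?_, ?_⟩ <;> linarith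

theorem exists_mem_closedSquare_mem_ball (p : ℤ × ℤ) :
    ∃ x ∈ closedSquare p, ∀ v ∈ squareCorners p, x ∈ Metric.ball (latticePoint v) 1 := by
  refine ⟨(p.1 + 1 / 2, p.2 + 1 / 2), ?_, fun v hv => mem_ball_prod_iff.2 ?_⟩
  · rw [mem_closedSquare]
    refine ⟨⟨?_, ?_⟩, ?_, ?_⟩ <;> simp only <;> linarith
  · obtain ⟨⟨a1, a2⟩, a3, a4⟩ := mem_squareCorners.1 hv
    rify at a1 a2 a3 a4
    simp only [latticePoint]
    refine ⟨⟨?_, ?_⟩, ?_, ?_⟩ <;> linarith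

theorem isPreconnected_ball_inter_carrier (S : Set (ℤ × ℤ)) (v : ℤ × ℤ) :
    IsPreconnected (Metric.ball (latticePoint v) 1 ∩ carrier S) := by
  rcases (Metric.ball (latticePoint v) 1 ∩ carrier S).eq_empty_or_nonempty with h | ⟨y, hyv, hy⟩
  · rw [h]
    exact isPreconnected_empty
  have hsub (p : ℤ × ℤ) (y : ℝ × ℝ) (hy : y ∈ Metric.ball (latticePoint v) 1)
      (hyp : y ∈ closedSquare p) : latticePoint v ∈ closedSquare p :=
    latticePoint_mem_closedSquare.2 (mem_squareCorners_of_mem_ball hyp hy)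
  obtain ⟨p, hp, hyp⟩ := mem_carrier.1 hy
  have hstar : StarConvex ℝ (latticePoint v) (Metric.ball (latticePoint v) 1 ∩ carrier S) := by
    rw [carrier_eq_iUnion]
    exact starConvex_inter_iUnion (convex_ball _ _) (Metric.mem_ball_self one_pos)
      (fun p : S => convex_closedSquare p) fun p => hsub p
  exact (hstar.isPathConnected ⟨Metric.mem_ball_self one_pos,
    mem_carrier.2 ⟨p, hp, hsub p y hyv hyp⟩⟩).isConnected.isPreconnected

theorem exists_common_corner {p q : ℤ × ℤ} (h : (closedSquare p ∩ closedSquare q).Nonempty) :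
    ∃ v, v ∈ squareCorners p ∧ v ∈ squareCorners q := by
  obtain ⟨x, hp, hq⟩ := h
  obtain ⟨v, hv⟩ := exists_latticePoint_ball x
  exact ⟨v, mem_squareCorners_of_mem_ball hp hv, mem_squareCorners_of_mem_ball hq hv⟩

theorem eq_of_mem_squareCorners {M : Type*} {f : ℤ × ℤ → M} {p v w : ℤ × ℤ}
    (hf : ∀ v ∈ squareCorners p, ∀ w ∈ squareCorners p, latticeGraph.Adj v w → f v = f w)
    (hv : v ∈ squareCorners p) (hw : w ∈ squareCorners p) : f v = f w := by
  have hsame {u : ℤ × ℤ} (hu : u ∈ squareCorners p) : f u = f p := by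
    rw [mem_squareCorners] at hu
    have h1 : f u = f (p.1, u.2) := by
      by_cases h : u.1 = p.1
      · rw [← h]
      · exact hf _ (by rw [mem_squareCorners]; lia) _ (by rw [mem_squareCorners]; lia)
          (by rw [latticeGraph_adj_iff]; lia)
    have h2 : f (p.1, u.2) = f p := by
      by_cases h : u.2 = p.2
      · rw [h]
      · exact hf _ (by rw [mem_squareCorners]; lia) _ (by rw [mem_squareCorners]; lia)
          (by rw [latticeGraph_adj_iff]; lia)
    exact h1.trans h2
  exact (hsame hv).trans (hsame hw).symm

theorem eq_of_isEdge_eq {S : Set (ℤ × ℤ)} (hS : IsPreconnected (carrier S)) {M : Type*}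
    {f : ℤ × ℤ → M} (hf : ∀ v w, IsEdge S v w → f v = f w) {v w : ℤ × ℤ} (hv : v ∈ vertexSet S)
    (hw : w ∈ vertexSet S) : f v = f w := by
  have hsquare {p : ℤ × ℤ} (hp : p ∈ S) {v w : ℤ × ℤ} (hv : v ∈ squareCorners p)
      (hw : w ∈ squareCorners p) : f v = f w :=
    eq_of_mem_squareCorners (fun v hv w hw h => hf v w ⟨h, p, hp, hv, hw⟩) hv hw
  obtain ⟨p, hp, hvp⟩ := hv
  obtain ⟨q, hq, hwq⟩ := hw
  have hpq : f p = f q := by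
    rw [carrier_eq_iUnion] at hS
    refine eq_of_isPreconnected_iUnion (locallyFinite_closedSquare_subtype S)
      (fun p => isClosed_closedSquare p)
      (fun p => ⟨_, latticePoint_mem_closedSquare.2 (self_mem_squareCorners p)⟩) hS
      (f := fun p : S => f p) (fun p q hpq => ?_) ⟨p, hp⟩ ⟨q, hq⟩
    obtain ⟨u, hup, huq⟩ := exists_common_corner hpq
    exact (hsquare p.2 (self_mem_squareCorners _) hup).trans
      (hsquare q.2 huq (self_mem_squareCorners _))
  exact (hsquare hp hvp (self_mem_squareCorners p)).trans
    (hpq.trans (hsquare hq (self_mem_squareCorners q) hwq))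

/-- The four squares around the vertex `v`, in counter-clockwise order. -/
def squareAround (v : ℤ × ℤ) : Fin 4 → ℤ × ℤ :=
  ![v, (v.1 - 1, v.2), (v.1 - 1, v.2 - 1), (v.1, v.2 - 1)]

/-- The four neighbors of the vertex `v` in counter-clockwise order, such that the edge from `v` to
the `k`-th neighbor is the common side of the `k`-th and the `(k + 1)`-st square around `v`. -/
def neighborAround (v : ℤ × ℤ) : Fin 4 → ℤ × ℤ :=
  ![(v.1, v.2 + 1), (v.1 - 1, v.2), (v.1, v.2 - 1), (v.1 + 1, v.2)]

/-- `u` and `v` are the endpoints of the common side of two adjacent squares `p` and `q`, with `u`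
on the right and `v` on the left when the side is crossed from `p` to `q`. Thus `q` follows `p`
in the counter-clockwise order around `v`. -/
def IsCommonSide (p q u v : ℤ × ℤ) : Prop :=
  ∃ k, p = squareAround v k ∧ q = squareAround v (k + 1) ∧ u = neighborAround v k

theorem squareAround_injective (v : ℤ × ℤ) : Function.Injective (squareAround v) := by
  intro j k
  fin_cases j <;> fin_cases k <;>
    simp only [squareAround, Prod.ext_iff, Fin.reduceFinMk, Matrix.cons_val] <;> lia

theorem isCommonSide_around (v : ℤ × ℤ) (k : Fin 4) :
    IsCommonSide (squareAround v k) (squareAround v (k + 1)) (neighborAround v k) v :=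
  ⟨k, rfl, rfl, rfl⟩

theorem IsCommonSide.mem_corners {p q u v : ℤ × ℤ} (h : IsCommonSide p q u v) :
    (u ∈ squareCorners p ∧ v ∈ squareCorners p) ∧ u ∈ squareCorners q ∧ v ∈ squareCorners q := by
  obtain ⟨k, rfl, rfl, rfl⟩ := h
  fin_cases k <;> simp [squareAround, neighborAround, mem_squareCorners]

theorem IsCommonSide.symm {p q u v : ℤ × ℤ} (h : IsCommonSide p q u v) : IsCommonSide q p v u := by
  obtain ⟨k, rfl, rfl, rfl⟩ := h
  refine ⟨k + 2, ?_⟩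
  fin_cases k <;> simp [squareAround, neighborAround]

theorem IsCommonSide.adj {p q u v : ℤ × ℤ} (h : IsCommonSide p q u v) : latticeGraph.Adj u v := by
  obtain ⟨k, rfl, rfl, rfl⟩ := h
  rw [latticeGraph_adj_iff]
  fin_cases k <;> simp [neighborAround]

theorem IsCommonSide.eq_or_eq {p q u v w : ℤ × ℤ} (h : IsCommonSide p q u v)
    (hwp : w ∈ squareCorners p) (hwq : w ∈ squareCorners q) : w = u ∨ w = v := by
  obtain ⟨k, rfl, rfl, rfl⟩ := h
  rw [mem_squareCorners] at hwp hwq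
  fin_cases k <;>
    simp only [squareAround, neighborAround, Prod.ext_iff, Fin.reduceFinMk, Fin.reduceAdd,
      Matrix.cons_val] at hwp hwq ⊢ <;> lia

theorem exists_isCommonSide_of_adj {p q : ℤ × ℤ} (h : latticeGraph.Adj p q) :
    ∃ u v, IsCommonSide p q u v := by
  suffices ∃ v k, p = squareAround v k ∧ q = squareAround v (k + 1) from
    let ⟨v, k, hp, hq⟩ := this
    ⟨_, v, k, hp, hq, rfl⟩
  rw [latticeGraph_adj_iff] at h
  obtain ⟨h2, h1 | h1⟩ | ⟨h1, h2 | h2⟩ := h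
  · exact ⟨p, 0, by simp [squareAround, h1, h2]⟩
  · exact ⟨(q.1, q.2 + 1), 2, by simp [squareAround, Prod.ext_iff, h1, h2]⟩
  · exact ⟨(p.1 + 1, p.2), 1, by simp [squareAround, Prod.ext_iff, h1, h2]⟩
  · exact ⟨q, 3, by simp [squareAround, Prod.ext_iff, h1, h2]⟩

theorem isCommonSide_or_of_mem_squareCorners {p q u v : ℤ × ℤ} (hup : u ∈ squareCorners p)
    (huq : u ∈ squareCorners q) (hvp : v ∈ squareCorners p) (hvq : v ∈ squareCorners q)
    (hpq : p ≠ q) (huv : u ≠ v) : IsCommonSide p q u v ∨ IsCommonSide p q v u := by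
  have hadj : latticeGraph.Adj p q := by
    rw [mem_squareCorners] at hup huq hvp hvq
    rw [Ne, Prod.ext_iff] at hpq huv
    rw [latticeGraph_adj_iff]
    lia
  obtain ⟨u', v', h⟩ := exists_isCommonSide_of_adj hadj
  rcases h.eq_or_eq hup huq with rfl | rfl <;> rcases h.eq_or_eq hvp hvq with rfl | rfl
  exacts [(huv rfl).elim, Or.inl h, Or.inr h, (huv rfl).elim]

theorem exists_potential {S : Set (ℤ × ℤ)} (hS : IsSimplyConnected (carrier S)) {M : Type*}
    [AddCommGroup M] (φ : ℤ × ℤ → ℤ × ℤ → M)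
    (hφ : ∀ p ∈ S, ∀ q ∈ S, ∀ u v, IsCommonSide p q u v → φ p v - φ p u = φ q v - φ q u) :
    ∃ F : ℤ × ℤ → M, ∀ p ∈ S, ∀ v ∈ squareCorners p, ∀ w ∈ squareCorners p,
      F w - F v = φ p w - φ p v := by
  have := hS.simplyConnectedSpace
  have := locallyPathConnectedSpace_carrier S
  have hwell {p q v w : ℤ × ℤ} (hp : p ∈ S) (hq : q ∈ S) (hvp : v ∈ squareCorners p)
      (hwp : w ∈ squareCorners p) (hvq : v ∈ squareCorners q) (hwq : w ∈ squareCorners q) :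
      φ p w - φ p v = φ q w - φ q v := by
    by_cases hpq : p = q
    · rw [hpq]
    by_cases hvw : v = w
    · simp only [hvw, sub_self]
    rcases isCommonSide_or_of_mem_squareCorners hvp hvq hwp hwq hpq hvw with h | h
    · exact hφ p hp q hq v w h
    · rw [← neg_sub, hφ p hp q hq w v h, neg_sub]
  have hdiff (v w : ℤ × ℤ) : ∃ m : M, ∀ p ∈ S, v ∈ squareCorners p → w ∈ squareCorners p →
      φ p w - φ p v = m := by
    by_cases h : ∃ p ∈ S, v ∈ squareCorners p ∧ w ∈ squareCorners p
    · obtain ⟨p, hp, hv, hw⟩ := h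
      exact ⟨φ p w - φ p v, fun q hq hvq hwq => hwell hq hp hvq hwq hv hw⟩
    · exact ⟨0, fun p hp hv hw => absurd ⟨p, hp, hv, hw⟩ h⟩
  choose c hc using hdiff
  obtain ⟨F, hF⟩ := exists_coboundary_of_simplyConnected
    (U := fun v => (Subtype.val ⁻¹' Metric.ball (latticePoint v) 1 : Set (carrier S)))
    (fun v => Metric.isOpen_ball.preimage continuous_subtype_val)
    (fun v => by
      rw [← Topology.IsInducing.subtypeVal.isPreconnected_image, Subtype.image_preimage_coe,
        Set.inter_comm]
      exact isPreconnected_ball_inter_carrier S v)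
    (fun x => exists_latticePoint_ball x) c
    (fun u v w x hu hv hw => by
      obtain ⟨p, hp, hxp⟩ := mem_carrier.1 x.2
      have hup := mem_squareCorners_of_mem_ball hxp hu
      have hvp := mem_squareCorners_of_mem_ball hxp hv
      have hwp := mem_squareCorners_of_mem_ball hxp hw
      rw [← hc u v p hp hup hvp, ← hc v w p hp hvp hwp, ← hc u w p hp hup hwp, add_comm,
        sub_add_sub_cancel])
  refine ⟨F, fun p hp v hv w hw => ?_⟩
  obtain ⟨x, hxp, hx⟩ := exists_mem_closedSquare_mem_ball p
  rw [hc v w p hp hv hw, ← hF v w ⟨⟨x, mem_carrier.2 ⟨p, hp, hxp⟩⟩, hx v hv, hx w hw⟩]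
  exact (neg_add_eq_sub _ _).symm

section Gudermannian

/-- The Gudermannian function `gd x = arctan (sinh x)`, written in the form in which it occurs in
the closure equation. -/
noncomputable def gudermannian (x : ℝ) : ℝ := 2 * Real.arctan (Real.exp x) - Real.pi / 2

theorem gudermannian_neg (x : ℝ) : gudermannian (-x) = -gudermannian x := by
  rw [gudermannian, gudermannian, Real.exp_neg, Real.arctan_inv_of_pos (Real.exp_pos x)]
  ring

theorem abs_gudermannian_lt (x : ℝ) : |gudermannian x| < Real.pi / 2 := by
  have h1 := Real.arctan_pos.2 (Real.exp_pos x)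
  have h2 := Real.arctan_lt_pi_div_two (Real.exp x)
  rw [gudermannian, abs_lt]
  constructor <;> linarith

theorem cos_gudermannian (x : ℝ) : Real.cos (gudermannian x) * Real.cosh x = 1 := by
  have h : 0 < 1 + Real.exp x ^ 2 := by positivity
  rw [gudermannian, Real.cos_sub_pi_div_two, Real.sin_two_mul, Real.sin_arctan, Real.cos_arctan,
    Real.cosh_eq, Real.exp_neg]
  field_simp
  rw [Real.sq_sqrt h.le, add_comm]

theorem sin_gudermannian (x : ℝ) : Real.sin (gudermannian x) * Real.cosh x = Real.sinh x := by
  rw [gudermannian, Real.sin_sub_pi_div_two, Real.cos_two_mul, Real.cos_sq_arctan,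
    Real.cosh_eq, Real.sinh_eq, Real.exp_neg]
  field_simp
  ring

theorem circleExp_gudermannian_mul_cosh (x : ℝ) :
    (Circle.exp (gudermannian x) : ℂ) * Real.cosh x = 1 + Real.sinh x * Complex.I := by
  rw [Circle.coe_exp, ← Complex.cos_add_sin_I, ← Complex.ofReal_cos, ← Complex.ofReal_sin, add_mul,
    mul_right_comm, ← Complex.ofReal_mul, ← Complex.ofReal_mul, cos_gudermannian, sin_gudermannian,
    Complex.ofReal_one]

theorem circleExp_gudermannian_sub_mul (x y : ℝ) :
    (Circle.exp (gudermannian (x - y)) : ℂ) * (Real.cosh y - Real.sinh x * Complex.I) =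
      Real.cosh x - Real.sinh y * Complex.I := by
  have hcosh : (Real.cosh y : ℂ) =
      Real.cosh x * Real.cosh (x - y) - Real.sinh x * Real.sinh (x - y) := by
    exact_mod_cast sub_sub_cancel x y ▸ Real.cosh_sub x (x - y)
  have hsinh : (Real.sinh y : ℂ) =
      Real.sinh x * Real.cosh (x - y) - Real.cosh x * Real.sinh (x - y) := by
    exact_mod_cast sub_sub_cancel x y ▸ Real.sinh_sub x (x - y)
  have hsq : (Real.cosh (x - y) : ℂ) ^ 2 = Real.sinh (x - y) ^ 2 + 1 := by
    exact_mod_cast Real.cosh_sq (x - y)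
  refine mul_left_cancel₀ (Complex.ofReal_ne_zero.2 (Real.cosh_pos (x - y)).ne') ?_
  rw [← mul_assoc, mul_comm (Real.cosh (x - y) : ℂ), circleExp_gudermannian_mul_cosh]
  linear_combination (1 + Real.sinh (x - y) * Complex.I) * hcosh +
    Real.cosh (x - y) * Complex.I * hsinh + Real.sinh x * Complex.I * hsq -
    Real.sinh x * Real.sinh (x - y) * Complex.I_sq

end Gudermannian

theorem exists_circle_mul_eq_of_norm_eq {y z : ℂ} (h : ‖y‖ = ‖z‖) : ∃ w : Circle, y = w * z := by
  rcases eq_or_ne z 0 with rfl | hz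
  · exact ⟨1, by simpa using h⟩
  · refine ⟨⟨y / z, mem_sphere_zero_iff_norm.2 ?_⟩, (div_mul_cancel₀ y hz).symm⟩
    rw [norm_div, h, div_self (norm_ne_zero_iff.2 hz)]

theorem exists_circle_of_sbtw {x t y : ℂ} (h : Sbtw ℝ x t y) :
    ∃ w : Circle, x = t + w * ‖t - x‖ ∧ y = t - w * ‖t - y‖ := by
  obtain ⟨w, hw⟩ := exists_circle_mul_eq_of_norm_eq
    (show ‖x - t‖ = ‖(‖t - x‖ : ℂ)‖ by rw [Complex.norm_real, norm_norm, norm_sub_rev])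
  have hray := h.wbtw.sameRay_vsub.norm_smul_eq
  rw [vsub_eq_sub, vsub_eq_sub, Complex.real_smul, Complex.real_smul, norm_sub_rev y t] at hray
  have hne : (‖t - x‖ : ℂ) ≠ 0 := by
    exact_mod_cast norm_ne_zero_iff.2 (sub_ne_zero.2 h.ne_left)
  refine ⟨w, by rw [← hw, add_sub_cancel], mul_left_cancel₀ hne ?_⟩
  linear_combination hray - ‖t - y‖ * hw

theorem sbtw_add_sub {z t : ℂ} (hz : z ≠ 0) {r s : ℝ} (hr : 0 < r) (hs : 0 < s) :
    Sbtw ℝ (t + z * r) t (t - z * s) := by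
  have hne {c : ℝ} (hc : 0 < c) : z * c ≠ 0 := mul_ne_zero hz (Complex.ofReal_ne_zero.2 hc.ne')
  refine ⟨wbtw_iff_sameRay_vsub.2 ?_, fun h => hne hr (by linear_combination -h),
    fun h => hne hs (by linear_combination h)⟩
  have hx : t -ᵥ (t + z * r) = r • -z := by rw [vsub_eq_sub, Complex.real_smul]; ring
  have hy : t - z * s -ᵥ t = s • -z := by rw [vsub_eq_sub, Complex.real_smul]; ring
  rw [hx, hy]
  exact ((SameRay.refl (-z)).nonneg_smul_left hr.le).nonneg_smul_right hs.le

theorem norm_add_mul_I_sq (a b : ℝ) : ‖(a + b * Complex.I : ℂ)‖ ^ 2 = a ^ 2 + b ^ 2 := by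
  rw [Complex.sq_norm, Complex.normSq_add_mul_I]

theorem OrientedRing.outer_pos (A : OrientedRing) : 0 < A.outer :=
  (abs_nonneg _).trans_lt A.abs_inner_lt_outer

theorem outerInnerOrthogonal_iff {A B : OrientedRing} :
    OuterInnerOrthogonal A B ↔ ‖B.center - A.center‖ ^ 2 = A.outer ^ 2 + B.inner ^ 2 := by
  constructor
  · rintro ⟨x, ⟨hA, hB⟩, hx⟩
    rw [OrientedRing.outerCircle, mem_sphere_iff_norm] at hA
    rw [OrientedRing.innerCircle, mem_sphere_iff_norm] at hB
    rw [← sub_sub_sub_cancel_left _ _ x, norm_sub_sq_real, hx, hA, hB, sq_abs]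
    ring
  · intro h
    rw [← norm_add_mul_I_sq, sq_eq_sq₀ (norm_nonneg _) (norm_nonneg _)] at h
    obtain ⟨w, hw⟩ := exists_circle_mul_eq_of_norm_eq h
    have hxA : A.center + w * A.outer - A.center = w * A.outer := add_sub_cancel_left _ _
    have hxB : A.center + w * A.outer - B.center = -(w * (B.inner * Complex.I)) := by
      linear_combination -hw
    refine ⟨A.center + w * A.outer, ⟨?_, ?_⟩, ?_⟩
    · rw [OrientedRing.outerCircle, mem_sphere_iff_norm, hxA, norm_mul, Circle.norm_coe, one_mul,
        Complex.norm_real, Real.norm_of_nonneg A.outer_pos.le]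
    · rw [OrientedRing.innerCircle, mem_sphere_iff_norm, hxB]
      simp only [norm_neg, norm_mul, Circle.norm_coe, Complex.norm_real, Complex.norm_I,
        Real.norm_eq_abs, one_mul, mul_one]
    · rw [hxA, hxB, ← rotation_apply, ← rotation_apply, inner_neg_right,
        LinearIsometryEquiv.inner_map_map, Complex.inner]
      simp

theorem ringsOrthogonal_iff {A B : OrientedRing} :
    RingsOrthogonal A B ↔ ‖B.center - A.center‖ ^ 2 = A.outer ^ 2 + B.inner ^ 2 ∧
      A.outer ^ 2 - A.inner ^ 2 = B.outer ^ 2 - B.inner ^ 2 := by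
  rw [RingsOrthogonal, outerInnerOrthogonal_iff, outerInnerOrthogonal_iff,
    norm_sub_rev A.center B.center]
  constructor <;> rintro ⟨h1, h2⟩ <;> exact ⟨h1, by linarith⟩

section Frame

variable (t : ℂ) (w : Circle)

theorem surjective_frame : Function.Surjective fun z : ℂ => t + w * z := fun x =>
  ⟨(x - t) / w, by field_simp [w.coe_ne_zero]; ring⟩

theorem frame_mem_sphere_iff (c z : ℂ) :
    t + w * z ∈ Metric.sphere (t + w * c) ‖c‖ ↔ ‖z‖ ^ 2 = 2 * (c.re * z.re + c.im * z.im) := by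
  rw [mem_sphere_iff_norm, add_sub_add_left_eq_sub, ← mul_sub, norm_mul, Circle.norm_coe, one_mul,
    ← sq_eq_sq₀ (norm_nonneg _) (norm_nonneg _), Complex.sq_norm, Complex.sq_norm, Complex.sq_norm,
    Complex.normSq_apply, Complex.normSq_apply, Complex.normSq_apply, Complex.sub_re,
    Complex.sub_im]
  constructor <;> intro h <;> linarith

theorem isCCW_frame_iff (x y : ℂ) :
    IsCCW (t + w * x) t (t + w * y) ↔ x.re * y.im < x.im * y.re := by
  have hw : (starRingEnd ℂ) w * w = 1 := by
    rw [mul_comm, Complex.mul_conj, Circle.normSq_coe, Complex.ofReal_one]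
  have h : (starRingEnd ℂ) (t - (t + w * x)) * (t + w * y - (t + w * x)) =
      (starRingEnd ℂ) x * (x - y) := by
    simp only [map_sub, map_add, map_mul]
    linear_combination (starRingEnd ℂ) x * (x - y) * hw
  rw [IsCCW, h, Complex.mul_im, Complex.conj_re, Complex.conj_im, Complex.sub_re, Complex.sub_im]
  constructor <;> intro h <;> linarith

theorem exists_norm_sq_eq {α s : ℝ} (hα : α ≠ 0) (hs : s ≠ 0) :
    ∃ z : ℂ, ‖z‖ ^ 2 = 2 * α * z.im ∧ ‖z‖ ^ 2 = 2 * s * z.re ∧ z.re ≠ 0 := by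
  have hne : α ^ 2 + s ^ 2 ≠ 0 := by positivity
  refine ⟨⟨2 * α ^ 2 * s / (α ^ 2 + s ^ 2), 2 * α * s ^ 2 / (α ^ 2 + s ^ 2)⟩, ?_, ?_, ?_⟩
  · rw [Complex.sq_norm, Complex.normSq_mk]; field
  · rw [Complex.sq_norm, Complex.normSq_mk]; field
  · positivity

theorem re_mul_im_sub_im_mul_re_pos {α s s' : ℝ} (hs : 0 < s) (hs' : s' < 0) {x y : ℂ}
    (hxα : ‖x‖ ^ 2 = 2 * α * x.im) (hxs : ‖x‖ ^ 2 = 2 * s * x.re) (hx : x.re ≠ 0)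
    (hyα : ‖y‖ ^ 2 = 2 * α * y.im) (hys : ‖y‖ ^ 2 = 2 * s' * y.re) (hy : y.re ≠ 0) :
    0 < α * (x.re * y.im - x.im * y.re) := by
  have hx0 : 0 < x.re := hx.lt_of_le' (by nlinarith [sq_nonneg ‖x‖])
  have hy0 : y.re < 0 := hy.lt_of_le (by nlinarith [sq_nonneg ‖y‖])
  have key : α * (x.re * y.im - x.im * y.re) = (s - s') * (x.re * -y.re) := by
    linear_combination x.re * (hys - hyα) / 2 + y.re * (hxα - hxs) / 2
  rw [key]
  exact mul_pos (by linarith) (mul_pos hx0 (by linarith))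

variable {t w} {A B D : OrientedRing} {α s s' : ℝ}

theorem frame_mem_inter_diff_iff (hA : A.center = t + w * (α * Complex.I))
    (hα : |A.inner| = |α|) (hB : B.center = t + w * s) (hs : B.outer = |s|)
    (hD : D.center = t + w * s') (hs' : D.outer = |s'|) (hss : s ≠ s') (z : ℂ) :
    t + w * z ∈ (A.innerCircle ∩ B.outerCircle) \ D.outerCircle ↔
      ‖z‖ ^ 2 = 2 * α * z.im ∧ ‖z‖ ^ 2 = 2 * s * z.re ∧ z.re ≠ 0 := by
  have hnorm : |α| = ‖(α * Complex.I : ℂ)‖ := by simp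
  rw [Set.mem_sdiff, Set.mem_inter_iff, OrientedRing.innerCircle, OrientedRing.outerCircle,
    OrientedRing.outerCircle, hα, hs, hs', hnorm, ← Real.norm_eq_abs, ← Real.norm_eq_abs,
    ← Complex.norm_real, ← Complex.norm_real, hA, hB, hD, frame_mem_sphere_iff,
    frame_mem_sphere_iff, frame_mem_sphere_iff]
  simp only [Complex.ofReal_re, Complex.ofReal_im, Complex.re_ofReal_mul, Complex.im_ofReal_mul,
    Complex.I_re, Complex.I_im, mul_zero, zero_mul, mul_one, add_zero, zero_add, ← mul_assoc]
  rw [and_assoc]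
  refine and_congr_right fun _ => and_congr_right fun h => not_congr ?_
  rw [h]
  constructor
  · intro h'
    exact (mul_eq_zero.1 (by linear_combination h' / 2)).resolve_left (sub_ne_zero.2 hss)
  · intro h'
    rw [h', mul_zero, mul_zero]

theorem exists_isCCW_iff (hA : A.center = t + w * (α * Complex.I)) (hα : |A.inner| = |α|)
    (hα0 : α ≠ 0) (hB : B.center = t + w * s) (hBs : B.outer = |s|) (hs : 0 < s)
    (hD : D.center = t + w * s') (hDs : D.outer = |s'|) (hs' : s' < 0) :
    (∃ x ∈ (A.innerCircle ∩ B.outerCircle) \ D.outerCircle,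
      ∃ y ∈ (A.innerCircle ∩ D.outerCircle) \ B.outerCircle, IsCCW x t y) ↔ α < 0 := by
  have hss : s' < s := hs'.trans hs
  have hmem_x := frame_mem_inter_diff_iff hA hα hB hBs hD hDs hss.ne'
  have hmem_y := frame_mem_inter_diff_iff hA hα hD hDs hB hBs hss.ne
  constructor
  · rintro ⟨x, hx, y, hy, h⟩
    obtain ⟨x, rfl⟩ := surjective_frame t w x
    obtain ⟨y, rfl⟩ := surjective_frame t w y
    obtain ⟨hxα, hxs, hx0⟩ := (hmem_x x).1 hx
    obtain ⟨hyα, hys, hy0⟩ := (hmem_y y).1 hy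
    have hpos := re_mul_im_sub_im_mul_re_pos hs hs' hxα hxs hx0 hyα hys hy0
    exact neg_of_mul_pos_left hpos (sub_neg.2 ((isCCW_frame_iff t w x y).1 h)).le
  · intro h
    obtain ⟨x, hxα, hxs, hx0⟩ := exists_norm_sq_eq hα0 hs.ne'
    obtain ⟨y, hyα, hys, hy0⟩ := exists_norm_sq_eq hα0 hs'.ne
    have hpos := re_mul_im_sub_im_mul_re_pos hs hs' hxα hxs hx0 hyα hys hy0
    exact ⟨t + w * x, (hmem_x x).2 ⟨hxα, hxs, hx0⟩, t + w * y, (hmem_y y).2 ⟨hyα, hys, hy0⟩,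
      (isCCW_frame_iff t w x y).2 (sub_neg.1 (neg_of_mul_pos_right hpos h.le))⟩

theorem cornerOriented_iff (hA : A.center = t + w * (α * Complex.I)) (hα : |A.inner| = |α|)
    (hB : B.center = t + w * s) (hBs : B.outer = |s|) (hs : 0 < s)
    (hD : D.center = t + w * s') (hDs : D.outer = |s'|) (hs' : s' < 0) :
    CornerOriented A B D t ↔ α = -A.inner := by
  rcases eq_or_ne A.inner 0 with h0 | h0
  · rw [h0, abs_zero, eq_comm, abs_eq_zero] at hα
    simp [CornerOriented, h0, hα]
  have hα0 : α ≠ 0 := abs_ne_zero.1 (hα ▸ abs_ne_zero.2 h0)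
  have hxy := exists_isCCW_iff hA hα hα0 hB hBs hs hD hDs hs'
  -- Turning the frame by a half turn exchanges the roles of `B` and `D`.
  have hyx := exists_isCCW_iff (A := A) (B := D) (D := B) (t := t) (w := -w) (α := -α)
    (s := -s') (s' := -s)
    (by simp [hA]) (by rwa [abs_neg]) (neg_ne_zero.2 hα0) (by simp [hD]) (by rwa [abs_neg])
    (neg_pos.2 hs') (by simp [hB]) (by rwa [abs_neg]) (neg_lt_zero.2 hs)
  have hswap : (∃ x ∈ (A.innerCircle ∩ B.outerCircle) \ D.outerCircle,
      ∃ y ∈ (A.innerCircle ∩ D.outerCircle) \ B.outerCircle, IsCCW y t x) ↔ 0 < α := by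
    rw [← neg_lt_zero, ← hyx]
    exact ⟨fun ⟨x, hx, y, hy, h⟩ => ⟨y, hy, x, hx, h⟩, fun ⟨x, hx, y, hy, h⟩ => ⟨y, hy, x, hx, h⟩⟩
  rw [CornerOriented, hxy, hswap]
  rcases abs_eq_abs.1 hα with h | h <;> rcases lt_or_gt_of_ne h0 with hneg | hpos <;> grind

end Frame

/-- A frame of a square with rings `A, B, C, D` at its corners: the tangent point `t` of the outer
circles of `B` and `D` and the direction `w` from `t` to the center of `B`, in which the centers of
the four rings have the coordinates `-i r_A`, `R_B`, `i r_C`, `-R_D`. -/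
structure IsSquareFrame (A B C D : OrientedRing) (t : ℂ) (w : Circle) : Prop where
  center_a : A.center = t + w * (-A.inner * Complex.I)
  center_b : B.center = t + w * B.outer
  center_c : C.center = t + w * (C.inner * Complex.I)
  center_d : D.center = t + w * -D.outer

namespace IsSquareFrame

variable {A B C D : OrientedRing} {t : ℂ} {w : Circle}

theorem rotate (h : IsSquareFrame A B C D t w) : IsSquareFrame C D A B t (-w) where
  center_a := by simp [h.center_c]
  center_b := by simp [h.center_d]
  center_c := by simp [h.center_a]
  center_d := by simp [h.center_b]

theorem mem_innerCircle (h : IsSquareFrame A B C D t w) : t ∈ A.innerCircle := by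
  rw [OrientedRing.innerCircle, mem_sphere_iff_norm, h.center_a]
  simp [Circle.norm_coe]

theorem mem_outerCircle (h : IsSquareFrame A B C D t w) : t ∈ B.outerCircle := by
  rw [OrientedRing.outerCircle, mem_sphere_iff_norm, h.center_b]
  simp [Circle.norm_coe, abs_of_pos B.outer_pos]

theorem cornerOriented (h : IsSquareFrame A B C D t w) : CornerOriented A B D t :=
  (cornerOriented_iff (α := -A.inner) (s := B.outer) (s' := -D.outer) (by simp [h.center_a])
    (abs_neg _).symm h.center_b (abs_of_pos B.outer_pos).symm B.outer_pos (by simp [h.center_d])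
    (by rw [abs_neg, abs_of_pos D.outer_pos]) (neg_lt_zero.2 D.outer_pos)).2 rfl

theorem squareCondition (h : IsSquareFrame A B C D t w) : SquareCondition A B C D := by
  refine ⟨t, h.mem_innerCircle, h.rotate.mem_innerCircle, h.mem_outerCircle,
    h.rotate.mem_outerCircle, ?_, h.cornerOriented, h.rotate.cornerOriented⟩
  rw [h.center_b, h.center_d, mul_neg, ← sub_eq_add_neg]
  exact sbtw_add_sub w.coe_ne_zero B.outer_pos D.outer_pos

end IsSquareFrame

theorem exists_center_eq_of_outerInnerOrthogonal {A B : OrientedRing} {t : ℂ} {w : Circle}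
    (h : OuterInnerOrthogonal B A) (ht : t ∈ A.innerCircle) (hB : B.center = t + w * B.outer) :
    ∃ α : ℝ, A.center = t + w * (α * Complex.I) ∧ |A.inner| = |α| := by
  obtain ⟨c, hc⟩ : ∃ c, t + w * c = A.center := surjective_frame t w A.center
  have hnorm : |A.inner| = ‖c‖ := by
    rw [OrientedRing.innerCircle, mem_sphere_iff_norm, ← hc, sub_add_cancel_left, norm_neg,
      norm_mul, Circle.norm_coe, one_mul] at ht
    exact ht.symm
  have hre : c.re = 0 := by
    have horth := outerInnerOrthogonal_iff.1 h
    rw [hB, ← hc, add_sub_add_left_eq_sub, ← mul_sub, norm_mul, Circle.norm_coe, one_mul,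
      ← sq_abs A.inner, hnorm, Complex.sq_norm, Complex.sq_norm, Complex.normSq_apply,
      Complex.normSq_apply, Complex.sub_re, Complex.sub_im, Complex.ofReal_re,
      Complex.ofReal_im] at horth
    exact (mul_eq_zero.1 (show B.outer * c.re = 0 by linarith)).resolve_left B.outer_pos.ne'
  have hcI : c = c.im * Complex.I := by simpa [hre] using (Complex.re_add_im c).symm
  refine ⟨c.im, by rw [← hcI, hc], ?_⟩
  rw [hnorm, hcI]
  simp

theorem exists_isSquareFrame {A B C D : OrientedRing} (h : SquareCondition A B C D)
    (hA : OuterInnerOrthogonal B A) (hC : OuterInnerOrthogonal B C) :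
    ∃ t w, IsSquareFrame A B C D t w := by
  obtain ⟨t, htA, htC, htB, htD, hbtw, horA, horC⟩ := h
  obtain ⟨w, hB, hD⟩ := exists_circle_of_sbtw hbtw
  rw [mem_sphere_iff_norm.1 htB] at hB
  rw [mem_sphere_iff_norm.1 htD, sub_eq_add_neg, ← mul_neg] at hD
  obtain ⟨α, hA, hα⟩ := exists_center_eq_of_outerInnerOrthogonal hA htA hB
  obtain ⟨γ, hC, hγ⟩ := exists_center_eq_of_outerInnerOrthogonal hC htC hB
  have hBs : B.outer = |B.outer| := (abs_of_pos B.outer_pos).symm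
  have hDs : D.outer = |-D.outer| := by rw [abs_neg, abs_of_pos D.outer_pos]
  have hDneg : -D.outer < 0 := neg_lt_zero.2 D.outer_pos
  have hα' : α = -A.inner := (cornerOriented_iff hA hα hB hBs B.outer_pos
    (by simpa using hD) hDs hDneg).1 horA
  have hγ' : -γ = -C.inner := (cornerOriented_iff (w := -w) (by simpa using hC) (by rwa [abs_neg])
    (by simpa using hD) (abs_of_pos D.outer_pos).symm D.outer_pos (by simpa using hB)
    (by rwa [abs_neg]) (neg_lt_zero.2 B.outer_pos)).1 horC
  exact ⟨t, w, by simpa [hα'] using hA, hB, by rwa [neg_inj.1 hγ'] at hC, hD⟩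

theorem OrientedRing.eq_mul_cosh_and_eq_mul_sinh (A : OrientedRing) {ℓ : ℝ} (hℓ : 0 < ℓ)
    (h : A.outer ^ 2 - A.inner ^ 2 = ℓ ^ 2) :
    A.outer = ℓ * Real.cosh (Real.arsinh (A.inner / ℓ)) ∧
      A.inner = ℓ * Real.sinh (Real.arsinh (A.inner / ℓ)) := by
  have hinner : A.inner = ℓ * Real.sinh (Real.arsinh (A.inner / ℓ)) := by
    rw [Real.sinh_arsinh, mul_div_cancel₀ _ hℓ.ne']
  refine ⟨?_, hinner⟩
  rw [← sq_eq_sq₀ A.outer_pos.le (by positivity), mul_pow, Real.cosh_sq, mul_add, ← mul_pow,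
    ← hinner]
  linarith

theorem IsOrthogonalRingPattern.exists_hasRhoRadii {S : Set (ℤ × ℤ)} {P : ℤ × ℤ → OrientedRing}
    (hS : IsPreconnected (carrier S)) (hP : IsOrthogonalRingPattern S P) :
    ∃ (ℓ : ℝ) (ρ : ℤ × ℤ → ℝ), 0 < ℓ ∧ HasRhoRadii S P ℓ ρ := by
  rcases (vertexSet S).eq_empty_or_nonempty with hempty | ⟨o, ho⟩
  · exact ⟨1, 0, one_pos, by simp [HasRhoRadii, hempty]⟩
  have hpos : 0 < (P o).outer ^ 2 - (P o).inner ^ 2 :=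
    sub_pos.2 (sq_lt_sq.2 ((P o).abs_inner_lt_outer.trans_le (le_abs_self _)))
  refine ⟨√((P o).outer ^ 2 - (P o).inner ^ 2), _, Real.sqrt_pos.2 hpos, fun v hv =>
    (P v).eq_mul_cosh_and_eq_mul_sinh (Real.sqrt_pos.2 hpos) ?_⟩
  rw [Real.sq_sqrt hpos.le]
  exact eq_of_isEdge_eq hS (f := fun v => (P v).outer ^ 2 - (P v).inner ^ 2)
    (fun v w hvw => (ringsOrthogonal_iff.1 (hP.orthogonal v w hvw)).2) hv ho

section Frames

variable {S : Set (ℤ × ℤ)} {P : ℤ × ℤ → OrientedRing} {ℓ : ℝ} {ρ : ℤ × ℤ → ℝ} {p q u v : ℤ × ℤ}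

/-- The center of the ring with `ρ`-radius `ρ v` at the corner `v` of the square `p`, in the
coordinates given by a frame of the square, for `ℓ = 1`. -/
noncomputable def cornerOffset (ρ : ℤ × ℤ → ℝ) (p v : ℤ × ℤ) : ℂ :=
  if v.1 = p.1 then
    if v.2 = p.2 then -(Real.sinh (ρ v) * Complex.I) else -Real.cosh (ρ v)
  else if v.2 = p.2 then Real.cosh (ρ v) else Real.sinh (ρ v) * Complex.I

/-- In the frame `(t, w)` of the square `p`, the points that `z` assigns to the corners of `p` are
the centers of rings with radii `ℓ cosh ρ`, `ℓ sinh ρ` that satisfy the square condition. -/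
def IsFrameAt (ℓ : ℝ) (ρ : ℤ × ℤ → ℝ) (z : ℤ × ℤ → ℂ) (p : ℤ × ℤ) (t : ℂ) (w : Circle) : Prop :=
  ∀ v ∈ squareCorners p, z v = t + w * (ℓ * cornerOffset ρ p v)

theorem norm_cornerOffset_sub_sq (ρ : ℤ × ℤ → ℝ) (hu : u ∈ squareCorners p)
    (hv : v ∈ squareCorners p) (h : latticeGraph.Adj u v) :
    ‖cornerOffset ρ p v - cornerOffset ρ p u‖ ^ 2 =
      Real.cosh (ρ u) ^ 2 + Real.sinh (ρ v) ^ 2 := by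
  have hu' := Real.cosh_sq (ρ u)
  have hv' := Real.cosh_sq (ρ v)
  rw [Complex.sq_norm, Complex.normSq_apply]
  rw [latticeGraph_adj_iff] at h
  rw [squareCorners] at hu hv
  rcases hu with rfl | rfl | rfl | rfl <;> rcases hv with rfl | rfl | rfl | rfl <;>
    simp only [cornerOffset, left_eq_add, add_eq_left, one_ne_zero, or_self, and_false,
      or_false, and_self, and_true, or_true, true_or, if_true, if_false, Complex.sub_re,
      Complex.sub_im, Complex.neg_re, Complex.neg_im, Complex.mul_re, Complex.mul_im,
      Complex.ofReal_re, Complex.ofReal_im, Complex.I_re, Complex.I_im] at h ⊢ <;> linarith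

theorem IsCommonSide.circleExp_mul_cornerOffset_sub (h : IsCommonSide p q u v) (ρ : ℤ × ℤ → ℝ) :
    Circle.exp (gudermannian (ρ u - ρ v)) * (cornerOffset ρ q v - cornerOffset ρ q u) =
      cornerOffset ρ p v - cornerOffset ρ p u := by
  have key := circleExp_gudermannian_sub_mul (ρ u) (ρ v)
  have key' := circleExp_gudermannian_sub_mul (-ρ v) (-ρ u)
  rw [neg_sub_neg, Real.cosh_neg, Real.cosh_neg, Real.sinh_neg, Real.sinh_neg,
    Complex.ofReal_neg, Complex.ofReal_neg] at key'
  obtain ⟨k, rfl, rfl, rfl⟩ := h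
  have hne (n : ℤ) : n ≠ n - 1 := by lia
  fin_cases k <;>
    simp only [cornerOffset, squareAround, neighborAround, Fin.reduceFinMk, Fin.reduceAdd,
      Matrix.cons_val, add_eq_left, one_ne_zero, hne, if_true, if_false] at key key' ⊢
  · linear_combination key
  · linear_combination key'
  · linear_combination -key
  · linear_combination -key'

theorem IsCommonSide.cornerOffset_sub_ne_zero (h : IsCommonSide p q u v) (ρ : ℤ × ℤ → ℝ) :
    cornerOffset ρ p v - cornerOffset ρ p u ≠ 0 := by
  have hnorm := norm_cornerOffset_sub_sq ρ h.mem_corners.1.1 h.mem_corners.1.2 h.adj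
  rw [← norm_ne_zero_iff, ← sq_pos_iff, hnorm]
  positivity

theorem IsFrameAt.sub_eq {z : ℤ × ℤ → ℂ} {t : ℂ} {w : Circle} (h : IsFrameAt ℓ ρ z p t w)
    (hu : u ∈ squareCorners p) (hv : v ∈ squareCorners p) :
    z v - z u = w * (ℓ * (cornerOffset ρ p v - cornerOffset ρ p u)) := by
  rw [h u hu, h v hv]
  ring

theorem IsFrameAt.circleExp_mul_eq (hℓ : ℓ ≠ 0) {z : ℤ × ℤ → ℂ} {t t' : ℂ} {w w' : Circle}
    (h : IsFrameAt ℓ ρ z p t w) (h' : IsFrameAt ℓ ρ z q t' w') (hpq : IsCommonSide p q u v) :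
    w' = Circle.exp (gudermannian (ρ u - ρ v)) * w := by
  obtain ⟨⟨hup, hvp⟩, huq, hvq⟩ := hpq.mem_corners
  have hzero := hpq.symm.cornerOffset_sub_ne_zero ρ
  have hside := (h.sub_eq hup hvp).symm.trans (h'.sub_eq huq hvq)
  rw [← hpq.circleExp_mul_cornerOffset_sub ρ] at hside
  refine Circle.ext (mul_right_cancel₀ (mul_ne_zero (Complex.ofReal_ne_zero.2 hℓ) hzero) ?_)
  rw [Circle.coe_mul]
  linear_combination hside

theorem isSquareFrame_iff (hP : HasRhoRadii S P ℓ ρ) (hp : p ∈ S) {t : ℂ} {w : Circle} :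
    IsSquareFrame (P p) (P (p.1 + 1, p.2)) (P (p.1 + 1, p.2 + 1)) (P (p.1, p.2 + 1)) t w ↔
      IsFrameAt ℓ ρ (fun v => (P v).center) p t w := by
  have hrad (v : ℤ × ℤ) (hv : v ∈ squareCorners p) := hP v ⟨p, hp, hv⟩
  simp only [squareCorners, Set.mem_insert_iff, Set.mem_singleton_iff, forall_eq_or_imp,
    forall_eq] at hrad
  obtain ⟨hA, hB, hC, hD⟩ := hrad
  have hframe : IsSquareFrame (P p) (P (p.1 + 1, p.2)) (P (p.1 + 1, p.2 + 1)) (P (p.1, p.2 + 1))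
      t w ↔ _ ∧ _ ∧ _ ∧ _ := ⟨fun ⟨a, b, c, d⟩ => ⟨a, b, c, d⟩, fun ⟨a, b, c, d⟩ => ⟨a, b, c, d⟩⟩
  rw [hframe]
  simp only [IsFrameAt, squareCorners, Set.mem_insert_iff, Set.mem_singleton_iff, forall_eq_or_imp,
    forall_eq, hA, hB, hC, hD, cornerOffset, add_eq_left, one_ne_zero, if_true, if_false]
  push_cast
  simp only [mul_neg, neg_mul, mul_assoc]

theorem IsFrameAt.ringsOrthogonal (hP : HasRhoRadii S P ℓ ρ) (hp : p ∈ S) {t : ℂ} {w : Circle}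
    (h : IsFrameAt ℓ ρ (fun v => (P v).center) p t w) (hu : u ∈ squareCorners p)
    (hv : v ∈ squareCorners p) (huv : latticeGraph.Adj u v) : RingsOrthogonal (P u) (P v) := by
  obtain ⟨hRu, hru⟩ := hP u ⟨p, hp, hu⟩
  obtain ⟨hRv, hrv⟩ := hP v ⟨p, hp, hv⟩
  rw [ringsOrthogonal_iff, h.sub_eq hu hv, norm_mul, norm_mul, Circle.norm_coe, one_mul, mul_pow,
    norm_cornerOffset_sub_sq ρ hu hv huv, Complex.norm_real, Real.norm_eq_abs, sq_abs, hRu, hru,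
    hRv, hrv]
  constructor
  · ring
  · linear_combination ℓ ^ 2 * (Real.cosh_sq (ρ u) - Real.cosh_sq (ρ v))

theorem isOrthogonalRingPattern_iff (hP : HasRhoRadii S P ℓ ρ) :
    IsOrthogonalRingPattern S P ↔
      ∀ p ∈ S, ∃ t w, IsFrameAt ℓ ρ (fun v => (P v).center) p t w := by
  constructor
  · intro h p hp
    have hB (v : ℤ × ℤ) (hv : v ∈ squareCorners p)
        (hadj : latticeGraph.Adj (p.1 + 1, p.2) v) :
        OuterInnerOrthogonal (P (p.1 + 1, p.2)) (P v) :=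
      (h.orthogonal _ _ ⟨hadj, p, hp, by simp [squareCorners], hv⟩).1
    obtain ⟨t, w, hw⟩ := exists_isSquareFrame (h.square p.1 p.2 hp)
      (hB _ (by simp [squareCorners]) (by simp [latticeGraph_adj_iff]))
      (hB _ (by simp [squareCorners]) (by simp [latticeGraph_adj_iff]))
    exact ⟨t, w, (isSquareFrame_iff hP hp).1 hw⟩
  · intro h
    refine ⟨?_, fun m n hmn => ?_⟩
    · rintro u v ⟨huv, p, hp, hu, hv⟩
      obtain ⟨t, w, hw⟩ := h p hp
      exact hw.ringsOrthogonal hP hp hu hv huv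
    · obtain ⟨t, w, hw⟩ := h (m, n) hmn
      exact ((isSquareFrame_iff hP hmn).2 hw).squareCondition

end Frames

section Closure

variable {S : Set (ℤ × ℤ)} {P : ℤ × ℤ → OrientedRing} {ℓ : ℝ} {ρ : ℤ × ℤ → ℝ}

theorem isInteriorVertex_iff {v : ℤ × ℤ} : IsInteriorVertex S v ↔ ∀ k, squareAround v k ∈ S := by
  simp [IsInteriorVertex, squareAround, Fin.forall_fin_succ]

theorem sum_latticeNeighbors {M : Type*} [AddCommMonoid M] (v : ℤ × ℤ) (f : ℤ × ℤ → M) :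
    ∑ w ∈ latticeNeighbors v, f w = ∑ k, f (neighborAround v k) := by
  have himage : latticeNeighbors v = Finset.univ.image (neighborAround v) := by
    ext w
    simp only [latticeNeighbors, neighborAround, Finset.mem_insert, Finset.mem_singleton,
      Finset.mem_image, Finset.mem_univ, true_and, Prod.ext_iff, Fin.exists_fin_succ,
      Matrix.cons_val_zero, Matrix.cons_val_succ, Matrix.cons_val_fin_one, exists_const]
    lia
  have hinj : Function.Injective (neighborAround v) := by
    intro j k
    fin_cases j <;> fin_cases k <;>
      simp only [neighborAround, Prod.ext_iff, Fin.reduceFinMk, Matrix.cons_val] <;> lia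
  rw [himage, Finset.sum_image hinj.injOn]

theorem closureEquation_iff : ClosureEquation S ρ ↔ ∀ v, (∀ k, squareAround v k ∈ S) →
    ∑ k, gudermannian (ρ (neighborAround v k) - ρ v) = 0 := by
  simp only [ClosureEquation, isInteriorVertex_iff, sum_latticeNeighbors]
  refine forall₂_congr fun v _ => ?_
  have hterm (x y : ℝ) :
      2 * Real.arctan (Real.exp (x - y)) = Real.pi / 2 - gudermannian (y - x) := by
    rw [← neg_sub x y, gudermannian_neg, gudermannian]
    ring
  simp only [hterm, Finset.sum_sub_distrib, Finset.sum_const, Finset.card_univ, Fintype.card_fin,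
    nsmul_eq_mul]
  constructor <;> intro h <;> linarith

theorem prod_eq_one_of_forall_add_eq_mul {ι G : Type*} [Fintype ι] [AddGroup ι] [CommGroup G]
    {w c : ι → G} (i : ι) (h : ∀ k, w (k + i) = c k * w k) : ∏ k, c k = 1 := by
  have hshift : ∏ k, w (k + i) = ∏ k, w k := Equiv.prod_comp (Equiv.addRight i) w
  rwa [Finset.prod_congr rfl fun k _ => h k, Finset.prod_mul_distrib, mul_eq_right] at hshift

theorem circleExp_eq_one_iff_of_abs_lt {x : ℝ} (hx : |x| < 2 * Real.pi) :
    Circle.exp x = 1 ↔ x = 0 := by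
  refine ⟨fun h => ?_, fun h => by rw [h, Circle.exp_zero]⟩
  obtain ⟨n, rfl⟩ := Circle.exp_eq_one.1 h
  rw [abs_mul, abs_of_pos Real.two_pi_pos, mul_lt_iff_lt_one_left Real.two_pi_pos] at hx
  have hn : |n| < 1 := by exact_mod_cast hx
  rw [Int.abs_lt_one_iff.1 hn, Int.cast_zero, zero_mul]

theorem closureEquation_of_isFrameAt (hℓ : ℓ ≠ 0) {z : ℤ × ℤ → ℂ}
    (h : ∀ p ∈ S, ∃ t w, IsFrameAt ℓ ρ z p t w) : ClosureEquation S ρ := by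
  rw [closureEquation_iff]
  intro v hv
  choose t w hw using fun k => h (squareAround v k) (hv k)
  have hprod := prod_eq_one_of_forall_add_eq_mul 1 fun k =>
    (hw k).circleExp_mul_eq hℓ (hw (k + 1)) (isCommonSide_around v k)
  rw [Fin.prod_univ_four, ← Circle.exp_add, ← Circle.exp_add, ← Circle.exp_add,
    ← Fin.sum_univ_four fun k => gudermannian (ρ (neighborAround v k) - ρ v)] at hprod
  refine (circleExp_eq_one_iff_of_abs_lt ?_).1 hprod
  have habs (k : Fin 4) := abs_lt.1 (abs_gudermannian_lt (ρ (neighborAround v k) - ρ v))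
  rw [Fin.sum_univ_four, abs_lt]
  constructor <;> linarith [habs 0, habs 1, habs 2, habs 3]

theorem IsOrthogonalRingPattern.closureEquation (h : IsOrthogonalRingPattern S P) (hℓ : ℓ ≠ 0)
    (hP : HasRhoRadii S P ℓ ρ) : ClosureEquation S ρ :=
  closureEquation_of_isFrameAt hℓ ((isOrthogonalRingPattern_iff hP).1 h)

end Closure

section Existence

theorem exists_cyclic_potential_of_sum_eq_zero {M : Type*} [AddCommGroup M] {n : ℕ}
    {g : Fin (n + 1) → M} (hg : ∑ k, g k = 0) :
    ∃ b : Fin (n + 1) → M, ∀ k, b (k + 1) - b k = g k := by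
  refine ⟨Fin.partialSum (Fin.init g), fun k => ?_⟩
  induction k using Fin.lastCases with
  | last =>
    rw [Fin.last_add_one, Fin.partialSum_zero, zero_sub, neg_eq_iff_add_eq_zero, ← hg,
      Fin.sum_univ_castSucc, Fin.partialSum, Fin.val_last, add_left_inj, ← List.sum_ofFn,
      List.take_of_length_le (List.length_ofFn).le]
    rfl
  | cast k =>
    rw [Fin.coeSucc_eq_succ, Fin.partialSum_succ, add_sub_cancel_left, Fin.init]

theorem exists_cyclic_potential {M : Type*} [AddCommGroup M] {n : ℕ} (g : Fin (n + 1) → M)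
    (s : Fin (n + 1) → Prop) (hg : (∀ k, s k) → ∑ k, g k = 0) :
    ∃ b : Fin (n + 1) → M, ∀ k, s k → b (k + 1) - b k = g k := by
  classical
  by_cases h : ∀ k, s k
  · obtain ⟨b, hb⟩ := exists_cyclic_potential_of_sum_eq_zero (hg h)
    exact ⟨b, fun k _ => hb k⟩
  · obtain ⟨j, hj⟩ := not_forall.1 h
    obtain ⟨b, hb⟩ := exists_cyclic_potential_of_sum_eq_zero
      (g := Function.update g j (g j - ∑ k, g k)) (by
        rw [Finset.sum_update_of_mem (Finset.mem_univ j), Finset.sdiff_singleton_eq_erase,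
          Finset.sum_erase_eq_sub (Finset.mem_univ j)]
        abel)
    refine ⟨b, fun k hk => ?_⟩
    rw [hb k, Function.update_of_ne (fun hkj : k = j => hj (hkj ▸ hk))]

variable {S : Set (ℤ × ℤ)} {ρ : ℤ × ℤ → ℝ}

theorem ClosureEquation.exists_angles_around (h : ClosureEquation S ρ) :
    ∃ Θ : ℤ × ℤ → ℤ × ℤ → ℝ, ∀ p ∈ S, ∀ q u v, IsCommonSide p q u v →
      Θ q v - Θ p v = gudermannian (ρ u - ρ v) := by
  choose b hb using fun v => exists_cyclic_potential
    (fun k => gudermannian (ρ (neighborAround v k) - ρ v)) (fun k => squareAround v k ∈ S)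
    (closureEquation_iff.1 h v)
  refine ⟨fun p v => Function.extend (squareAround v) (b v) 0 p, ?_⟩
  rintro p hp q u v ⟨k, rfl, rfl, rfl⟩
  simp only [(squareAround_injective v).extend_apply]
  exact hb v k hp

theorem ClosureEquation.exists_frame_angles (hS : IsSimplyConnected (carrier S))
    (h : ClosureEquation S ρ) :
    ∃ θ : ℤ × ℤ → ℝ, ∀ p ∈ S, ∀ q ∈ S, ∀ u v, IsCommonSide p q u v →
      θ q - θ p = gudermannian (ρ u - ρ v) := by
  obtain ⟨Θ, hΘ⟩ := h.exists_angles_around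
  obtain ⟨F, hF⟩ := exists_potential hS Θ fun p hp q hq u v hpq => by
    have hu := hΘ q hq p v u hpq.symm
    rw [← neg_sub (ρ u), gudermannian_neg] at hu
    linarith [hΘ p hp q u v hpq]
  refine ⟨fun p => Θ p p - F p, fun p hp q hq u v hpq => ?_⟩
  have hvp := hF p hp p (self_mem_squareCorners p) v hpq.mem_corners.1.2
  have hvq := hF q hq q (self_mem_squareCorners q) v hpq.mem_corners.2.2
  linarith [hΘ p hp q u v hpq]

theorem ClosureEquation.exists_isFrameAt (hS : IsSimplyConnected (carrier S))
    (h : ClosureEquation S ρ) (ℓ : ℝ) :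
    ∃ z : ℤ × ℤ → ℂ, ∀ p ∈ S, ∃ t w, IsFrameAt ℓ ρ z p t w := by
  obtain ⟨θ, hθ⟩ := h.exists_frame_angles hS
  obtain ⟨z, hz⟩ := exists_potential hS
    (fun p v => (Circle.exp (θ p) : ℂ) * (ℓ * cornerOffset ρ p v)) fun p hp q hq u v hpq => by
      have hexp : Circle.exp (θ q) = Circle.exp (θ p) * Circle.exp (gudermannian (ρ u - ρ v)) := by
        rw [← hθ p hp q hq u v hpq, ← Circle.exp_add, add_sub_cancel]
      rw [hexp, Circle.coe_mul]
      linear_combination -(Circle.exp (θ p) : ℂ) * ℓ * hpq.circleExp_mul_cornerOffset_sub ρ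
  refine ⟨z, fun p hp => ⟨z p - Circle.exp (θ p) * (ℓ * cornerOffset ρ p p), Circle.exp (θ p),
    fun v hv => ?_⟩⟩
  linear_combination hz p hp p (self_mem_squareCorners p) v hv

theorem ClosureEquation.exists_isOrthogonalRingPattern (hS : IsSimplyConnected (carrier S))
    (h : ClosureEquation S ρ) {ℓ : ℝ} (hℓ : 0 < ℓ) :
    ∃ P, IsOrthogonalRingPattern S P ∧ HasRhoRadii S P ℓ ρ := by
  obtain ⟨z, hz⟩ := h.exists_isFrameAt hS ℓ
  let P (v : ℤ × ℤ) : OrientedRing :=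
    { center := z v
      inner := ℓ * Real.sinh (ρ v)
      outer := ℓ * Real.cosh (ρ v)
      abs_inner_lt_outer := by
        rw [abs_mul, abs_of_pos hℓ, mul_lt_mul_iff_right₀ hℓ, Real.abs_sinh]
        exact (Real.sinh_lt_cosh _).trans_eq (Real.cosh_abs _) }
  have hP : HasRhoRadii S P ℓ ρ := fun v _ => ⟨rfl, rfl⟩
  exact ⟨P, (isOrthogonalRingPattern_iff hP).2 hz, hP⟩

end Existence

section Uniqueness

theorem eq_of_forall_adj_eq {V M : Type*} {G : SimpleGraph V} (hG : G.Preconnected) {f : V → M}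
    (hf : ∀ u v, G.Adj u v → f u = f v) (u v : V) : f u = f v := by
  have h := (SimpleGraph.reachable_iff_reflTransGen u v).1 (hG u v)
  simpa [Relation.reflTransGen_eq_self] using h.lift f hf

variable {S : Set (ℤ × ℤ)} {ℓ : ℝ} {ρ : ℤ × ℤ → ℝ}

theorem exists_rigid_motion_of_isFrameAt (hS : (latticeGraph.induce S).Connected) (hℓ : ℓ ≠ 0)
    {z z' : ℤ × ℤ → ℂ} (h : ∀ p ∈ S, ∃ t w, IsFrameAt ℓ ρ z p t w)
    (h' : ∀ p ∈ S, ∃ t w, IsFrameAt ℓ ρ z' p t w) :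
    ∃ (a : Circle) (b : ℂ), ∀ v ∈ vertexSet S, z' v = a * z v + b := by
  choose t w hw using fun p : S => h p p.2
  choose t' w' hw' using fun p : S => h' p p.2
  let a (p : S) : Circle := w' p / w p
  let b (p : S) : ℂ := t' p - a p * t p
  have hmotion (p : S) (v : ℤ × ℤ) (hv : v ∈ squareCorners p) : z' v = a p * z v + b p := by
    have haw : (a p * w p : ℂ) = w' p := by rw [← Circle.coe_mul, div_mul_cancel]
    rw [hw p v hv, hw' p v hv, ← haw]
    ring
  have hconst (p q : S) (hpq : (latticeGraph.induce S).Adj p q) : (a p, b p) = (a q, b q) := by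
    obtain ⟨u, v, hside⟩ := exists_isCommonSide_of_adj (SimpleGraph.induce_adj.1 hpq)
    have ha : a p = a q := by
      simp only [a]
      rw [(hw p).circleExp_mul_eq hℓ (hw q) hside, (hw' p).circleExp_mul_eq hℓ (hw' q) hside,
        mul_div_mul_left_eq_div]
    have hb := (hmotion p v hside.mem_corners.1.2).symm.trans (hmotion q v hside.mem_corners.2.2)
    rw [ha, add_right_inj] at hb
    rw [ha, hb]
  obtain ⟨o⟩ := hS.nonempty
  refine ⟨a o, b o, ?_⟩
  rintro v ⟨p, hp, hv⟩
  obtain ⟨ha, hb⟩ := Prod.mk.inj (eq_of_forall_adj_eq hS.preconnected hconst ⟨p, hp⟩ o)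
  rw [hmotion ⟨p, hp⟩ v hv, ha, hb]

end Uniqueness

theorem theorem1 (S : Set (ℤ × ℤ)) (hS : IsSimplyConnected (carrier S)) :
    (∀ P : ℤ × ℤ → OrientedRing, IsOrthogonalRingPattern S P →
      (∃ (ℓ : ℝ) (ρ : ℤ × ℤ → ℝ), 0 < ℓ ∧ HasRhoRadii S P ℓ ρ) ∧
      ∀ (ℓ : ℝ) (ρ : ℤ × ℤ → ℝ), 0 < ℓ → HasRhoRadii S P ℓ ρ → ClosureEquation S ρ) ∧
    (∀ ρ : ℤ × ℤ → ℝ, ClosureEquation S ρ → ∀ ℓ : ℝ, 0 < ℓ →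
      (∃ P : ℤ × ℤ → OrientedRing, IsOrthogonalRingPattern S P ∧ HasRhoRadii S P ℓ ρ) ∧
      ((latticeGraph.induce S).Connected →
        ∀ P Q : ℤ × ℤ → OrientedRing,
          IsOrthogonalRingPattern S P → HasRhoRadii S P ℓ ρ →
          IsOrthogonalRingPattern S Q → HasRhoRadii S Q ℓ ρ →
          ∃ a b : ℂ, ‖a‖ = 1 ∧ ∀ v ∈ vertexSet S, (Q v).center = a * (P v).center + b)) := by
  have hconn : IsPreconnected (carrier S) := hS.isPathConnected.isConnected.isPreconnected
  refine ⟨fun P hP => ⟨hP.exists_hasRhoRadii hconn, fun ℓ ρ hℓ hρ => hP.closureEquation hℓ.ne' hρ⟩,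
    fun ρ hρ ℓ hℓ => ⟨hρ.exists_isOrthogonalRingPattern hS hℓ, fun hsq P Q hP hPρ hQ hQρ => ?_⟩⟩
  obtain ⟨a, b, hab⟩ := exists_rigid_motion_of_isFrameAt hsq hℓ.ne'
    ((isOrthogonalRingPattern_iff hPρ).1 hP) ((isOrthogonalRingPattern_iff hQρ).1 hQ)
  exact ⟨a, b, a.norm_coe, hab⟩
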